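/- **Setting.** Let $d\in\mathbb N$, $T>0$, $p\in[1,\infty)$. Write $C_T=C([0,T],\mathbb R^d)$ with the supremum norm, and equip $\mathbb R^d\times C_T$ with the product (maximum) norm; all spaces carry their Borel $\sigma$-algebras. For a separable normed space $E$ let $\mathcal P_p(E)$ be the set of Borel probability measures on $E$ with finite $p$-th moment, with the Wasserstein metric $$\mathcal W_{E,p}(\mu,\nu)^p=\inf_{m}\iint_{E\times E}\|x-y\|^p\,m(dx,dy),$$ the infimum running over all couplings $m$ of $\mu$ and $\nu$. For $y=(y^1,\dots,y^N)\in E^N$ put $L^N(y)=\frac1N\sum_{i=1}^N\delta_{y^i}$. Let $b:[0,T]\times\mathbb R^d\times\mathcal P_p(\mathbb R^d)\to\mathbb R^d$ be Borel measurable, and assume that there is a constant $K_b$ with $$|b(t,x,\mu)-b(t,x',\mu')|^p\le K_b\big(|x-x'|^p+\mathcal W_{\mathbb R^d,p}(\mu,\mu')^p\big)\quad\text{for all } t,x,x',\mu,\mu',$$ and that $\int_0^T|b(t,x,\mu)|\,dt<\infty$ for some (equivalently, every) $(x,\mu)\in\mathbb R^d\times\mathcal P_p(\mathbb R^d)$.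 Let $(\Omega,\mathcal A,\mathbb P)$ be a probability space. For $N\ge1$ let $(\zeta^{(N)},W^{(N)})=(\zeta^{i,N},W^{i,N})_{1\le i\le N}:\Omega\to(\mathbb R^d\times C_T)^N$ be any family of random variables (no independence, exchangeability or moment condition is required), and let $\bar\zeta\in L^p(\Omega,\mathbb R^d)$, $\bar W\in L^p(\Omega,C_T)$. Consider the $N$-particle system, for $i=1,\dots,N$ and $t\in[0,T]$, $$X^{i,N}_t=\zeta^{i,N}+\int_0^t b\big(s,X^{i,N}_s,L^N(X^{(N)}_s)\big)\,ds+W^{i,N}_t,\tag{1}$$ and the McKean–Vlasov equation $$\bar X_t=\bar\zeta+\int_0^t b\big(s,\bar X_s,\mathcal L(\bar X_s)\big)\,ds+\bar W_t,\qquad t\in[0,T].\tag{2}$$ A solution of (1) at $\omega$ is an $N$-tuple of paths in $C_T$ satisfying (1) at this $\omega$. A solution of (2) is a random variable $\bar X:\Omega\to C_T$ with $\mathcal L(\bar X_t)\in\mathcal P_p(\mathbb R^d)$ for all $t\in[0,T]$ that satisfies (2) for $\mathbb P$-a.e. $\omega$. In both cases the integrand is required to be Lebesgue integrable on $[0,T]$.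 **Theorem 3.1.** 1. For every $N\ge1$ and every $\omega\in\Omega$, the system (1) has a unique solution $X^{(N)}(\omega)\in C_T^N$, and $\omega\mapsto X^{(N)}(\omega)$ is $\mathcal A$-measurable. 2. Equation (2) has a solution $\bar X$, and it is unique up to $\mathbb P$-a.s. equality. 3. There is a constant $C$, depending only on $d$, $T$, $p$ and $b$ (in particular neither on $N$ nor on the inputs nor on the probability space), such that for all $N\ge1$, all inputs as above, every solution $\bar X$ of (2) and every $X^{(N)}:\Omega\to C_T^N$ which satisfies (1) for $\mathbb P$-a.e. $\omega$, one has for $\mathbb P$-a.e. $\omega\in\Omega$ $$\mathcal W_{C_T,p}\big(L^N(X^{(N)}(\omega)),\mathcal L(\bar X)\big)^p\le C\,\mathcal W_{\mathbb R^d\times C_T,p}\big(L^N(\zeta^{(N)}(\omega),W^{(N)}(\omega)),\mathcal L(\bar\zeta,\bar W)\big)^p.$$ -/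

import Mathlib

open MeasureTheory Set
open scoped ENNReal NNReal

noncomputable section

/-- `m` is a coupling (transport plan) of `μ` and `ν`: its marginals are `μ` and `ν`. -/
def IsCoupling {E : Type*} [MeasurableSpace E] (m : Measure (E × E)) (μ ν : Measure E) : Prop :=
  m.map Prod.fst = μ ∧ m.map Prod.snd = ν

/-- The `p`-Wasserstein distance, with values in `[0, ∞]`:
`W_p(μ, ν) = (inf_m ∬ d(x, y)^p m(dx, dy))^{1/p}`, the infimum over all couplings `m`. -/
def wasserstein {E : Type*} [MeasurableSpace E] [PseudoEMetricSpace E] (p : ℝ)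
    (μ ν : Measure E) : ℝ≥0∞ :=
  (⨅ (m : Measure (E × E)) (_ : IsCoupling m μ ν), ∫⁻ z, edist z.1 z.2 ^ p ∂m) ^ (1 / p)

/-- The space `𝒫_p(E)` of probability measures on the normed space `E` with finite `p`-th moment. -/
@[ext]
structure ProbMoment (E : Type*) [NormedAddCommGroup E] [MeasurableSpace E] (p : ℝ) where
  toMeasure : Measure E
  isProb : IsProbabilityMeasure toMeasure
  moment_lt_top : ∫⁻ x, ‖x‖ₑ ^ p ∂toMeasure < ∞

/-- The topology of the Wasserstein metric on `𝒫_p(E)`: a set is open if it contains, around each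
of its points, a ball for `W_p`. -/
instance ProbMoment.instTopologicalSpace (E : Type*) [NormedAddCommGroup E] [MeasurableSpace E]
    (p : ℝ) : TopologicalSpace (ProbMoment E p) where
  IsOpen U := ∀ μ ∈ U, ∃ ε : ℝ≥0∞, 0 < ε ∧
    ∀ ν : ProbMoment E p, wasserstein p μ.toMeasure ν.toMeasure < ε → ν ∈ U
  isOpen_univ := fun _ _ => ⟨1, one_pos, fun _ _ => mem_univ _⟩
  isOpen_inter := by
    rintro U V hU hV μ ⟨hμU, hμV⟩
    obtain ⟨ε, hε, h⟩ := hU μ hμU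
    obtain ⟨δ, hδ, h'⟩ := hV μ hμV
    exact ⟨min ε δ, lt_min hε hδ, fun ν hν =>
      ⟨h ν (hν.trans_le (min_le_left _ _)), h' ν (hν.trans_le (min_le_right _ _))⟩⟩
  isOpen_sUnion := by
    rintro S hS μ ⟨U, hUS, hμU⟩
    obtain ⟨ε, hε, h⟩ := hS U hUS μ hμU
    exact ⟨ε, hε, fun ν hν => ⟨U, hUS, h ν hν⟩⟩

/-- `𝒫_p(E)` carries the Borel σ-algebra of the Wasserstein metric. -/
instance ProbMoment.instMeasurableSpace (E : Type*) [NormedAddCommGroup E] [MeasurableSpace E]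
    (p : ℝ) : MeasurableSpace (ProbMoment E p) := borel _

/-- The state space `ℝ^d` with the Euclidean norm. -/
abbrev State (d : ℕ) : Type := EuclideanSpace ℝ (Fin d)

/-- The path space `C_T = C([0, T], ℝ^d)`, with the supremum norm. -/
abbrev PathSpace (d : ℕ) (T : ℝ) : Type := C(Icc (0 : ℝ) T, State d)

/-- The path space carries its Borel σ-algebra. -/
instance PathSpace.instMeasurableSpace (d : ℕ) (T : ℝ) : MeasurableSpace (PathSpace d T) :=
  borel _

instance PathSpace.instBorelSpace (d : ℕ) (T : ℝ) : BorelSpace (PathSpace d T) := ⟨rfl⟩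

/-- The empirical measure `(1/N) ∑ δ_{y_i}` of a vector `y` of `N` points. -/
def empiricalMeasure {E : Type*} [MeasurableSpace E] {N : ℕ} (y : Fin N → E) : Measure E :=
  (N : ℝ≥0∞)⁻¹ • ∑ i, Measure.dirac (y i)

/-- The empirical measure as an element of `𝒫_p(E)`. -/
def empiricalLaw {E : Type*} [NormedAddCommGroup E] [MeasurableSpace E] [BorelSpace E] (p : ℝ)
    (hp : 0 ≤ p) {N : ℕ} [NeZero N] (y : Fin N → E) : ProbMoment E p where
  toMeasure := empiricalMeasure y
  isProb := ⟨by
    simp [empiricalMeasure, ENNReal.inv_mul_cancel (Nat.cast_ne_zero.2 (NeZero.ne N))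
      (ENNReal.natCast_ne_top N)]⟩
  moment_lt_top := by
    have hm : Measurable fun x : E => ‖x‖ₑ ^ p := by fun_prop
    simp only [empiricalMeasure, lintegral_smul_measure, lintegral_finsetSum_measure,
      lintegral_dirac' _ hm]
    refine ENNReal.mul_lt_top (ENNReal.inv_lt_top.2 (Nat.cast_pos.2 (NeZero.pos N))) ?_
    exact ENNReal.sum_lt_top.2 fun i _ => ENNReal.rpow_lt_top_of_nonneg hp (by simp)

/-- Lebesgue measure on the time interval `[0, T]`. -/
def timeMeasure (T : ℝ) : Measure (Icc (0 : ℝ) T) := volume.comap Subtype.val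

/-- A drift `b : [0, T] × ℝ^d × 𝒫_p(ℝ^d) → ℝ^d`. -/
abbrev Drift (d : ℕ) (T p : ℝ) : Type :=
  Icc (0 : ℝ) T → State d → ProbMoment (State d) p → State d

/-- The drift is (jointly) measurable, Lipschitz in space and measure uniformly in time,
`|b(t, x, μ) - b(t, x', μ')|^p ≤ K (|x - x'|^p + W_p(μ, μ')^p)`,
and integrable in time at one (equivalently, by the Lipschitz condition, at every) point `(x, μ)`. -/
structure DriftAssumption {d : ℕ} {T p : ℝ} (K : ℝ≥0) (b : Drift d T p) : Prop where
  measurable : Measurable fun q : Icc (0 : ℝ) T × State d × ProbMoment (State d) p =>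
    b q.1 q.2.1 q.2.2
  lipschitz : ∀ t x x' μ μ', edist (b t x μ) (b t x' μ') ^ p ≤
    K * (edist x x' ^ p + wasserstein p μ.toMeasure μ'.toMeasure ^ p)
  integrable : ∃ x μ, Integrable (fun t => b t x μ) (timeMeasure T)

/-- The path `x` satisfies `x_t = x₀ + ∫_0^t b(s, x_s, μ_s) ds + w_t` for all `t ∈ [0, T]`, where
`μ` is a given flow of measures; the integrand is required to be Lebesgue integrable. -/
def SolvesIntegralEq {d : ℕ} {T p : ℝ} (b : Drift d T p)
    (μ : Icc (0 : ℝ) T → ProbMoment (State d) p) (x₀ : State d) (w x : PathSpace d T) : Prop :=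
  Integrable (fun s => b s (x s) (μ s)) (timeMeasure T) ∧
    ∀ t, x t = x₀ + (∫ s in Iic t, b s (x s) (μ s) ∂timeMeasure T) + w t

/-- `X` is a solution of `dX_t = b(t, X_t, ℒ(X_t)) dt + dW_t`, `X_0 = ζ`: a random variable with
values in the path space, with `ℒ(X_t) ∈ 𝒫_p(ℝ^d)` for all `t`, which satisfies the integral
equation almost surely. -/
def IsMcKeanVlasovSolution {d : ℕ} {T p : ℝ} (b : Drift d T p) {Ω : Type*} [MeasurableSpace Ω]
    (P : Measure Ω) (ζ : Ω → State d) (W X : Ω → PathSpace d T) : Prop :=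
  Measurable X ∧ ∃ μ : Icc (0 : ℝ) T → ProbMoment (State d) p,
    (∀ t, (μ t).toMeasure = P.map fun ω => X ω t) ∧
    ∀ᵐ ω ∂P, SolvesIntegralEq b μ (ζ ω) (W ω) (X ω)

/-- The vector of paths `x = (x^1, …, x^N)` is a solution of the interacting particle system
`dx^i_t = b(t, x^i_t, (1/N) ∑_j δ_{x^j_t}) dt + dw^i_t`, `x^i_0 = z^i`, for given (deterministic)
initial data `z` and driving paths `w`. -/
def IsParticleSolution {d : ℕ} {T p : ℝ} (hp : 0 ≤ p) (b : Drift d T p) {N : ℕ} [NeZero N]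
    (z : Fin N → State d) (w x : Fin N → PathSpace d T) : Prop :=
  ∀ i, SolvesIntegralEq b (fun s => empiricalLaw p hp fun j => x j s) (z i) (w i) (x i)

end

/-!
The integral equation with a *given* flow of measures `μ` is an ordinary differential equation with a
drift that is Lipschitz in space. It has a Lipschitz continuous solution map `F` on
`ℝ^d × C_T` (`IsAdmissibleFlow.exists_solutionMap`), and the dependence on the flow is controlled by
`∫ W_p(μ_s, ν_s) ds` (`SolvesIntegralEq.edist_apply_le`). A McKean-Vlasov solution is a random path
`X = F(ζ, W)` where the flow is that of the laws of `X` itself.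

Since `W_p(ℒ(X_t), ℒ(Y_t))` is at most the `L^p` distance of `X_t` and `Y_t`, Grönwall's inequality
for `t ↦ W_p(ℒ(X_t), ℒ(Y_t))` bounds the distance of two solutions on the same probability space by
the distance of their inputs (`IsMcKeanVlasovSolution.exists_edist_le`). The same estimate, iterated,
makes a power of the map `X ↦ F(ζ, W)` on `L^p(Ω; C_T)` a contraction, which gives existence
(`IsMcKeanVlasovSolution.exists_solution`).

As `F` depends on the law of the input only, a solution can be carried over to any probability space
that carries an input with the same law. For two laws of inputs, every coupling is a probability space
that carries both, so stability on one space becomes stability in Wasserstein distance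
(`IsMcKeanVlasovSolution.exists_wasserstein_le`).

Finally, for each `ω` the particle system is the McKean-Vlasov equation on the probability space
`{1, …, N}` with the uniform distribution, on which laws are empirical measures
(`isParticleSolution_iff`). Thus its well-posedness and the pathwise estimate are instances of the
results above, and its solution map is continuous, hence measurable.
-/

/-! ### Integration in time -/

instance instIsFiniteMeasureTimeMeasure (T : ℝ) : IsFiniteMeasure (timeMeasure T) := by
  refine ⟨?_⟩
  rw [timeMeasure, (MeasurableEmbedding.subtype_coe measurableSet_Icc).comap_apply]
  refine (measure_mono (t := Icc 0 T) ?_).trans_lt (by simp)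
  rintro _ ⟨t, -, rfl⟩
  exact t.2

instance instNullSingletonClassTimeMeasure (T : ℝ) : NullSingletonClass (timeMeasure T) := by
  refine ⟨fun t => ?_⟩
  rw [timeMeasure, (MeasurableEmbedding.subtype_coe measurableSet_Icc).comap_apply]
  simp

/-- The exponential weight `e^{2(c+1)t}`. Its rate is chosen such that `c` times its primitive is
at most half of it, see `mul_lintegral_expWeight_le`. -/
noncomputable def expWeight (c : ℝ≥0) (t : ℝ) : ℝ≥0 := Real.toNNReal (Real.exp (2 * (c + 1) * t))

lemma one_le_expWeight (c : ℝ≥0) {t : ℝ} (ht : 0 ≤ t) : 1 ≤ expWeight c t := by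
  rw [expWeight, Real.one_le_toNNReal]
  exact Real.one_le_exp (by positivity)

lemma expWeight_mono (c : ℝ≥0) : Monotone (expWeight c) := fun s t h => by
  refine Real.toNNReal_le_toNNReal (Real.exp_le_exp.2 ?_)
  gcongr

lemma lintegral_exp_timeMeasure_le {T a : ℝ} (ha : 0 < a) (t : Icc (0 : ℝ) T) :
    ∫⁻ s in Iic t, ENNReal.ofReal (Real.exp (a * s)) ∂timeMeasure T ≤
      ENNReal.ofReal (Real.exp (a * t) / a) := by
  have hm : Measurable fun s : ℝ => ENNReal.ofReal (Real.exp (a * s)) := by fun_prop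
  calc ∫⁻ s in Iic t, ENNReal.ofReal (Real.exp (a * s)) ∂timeMeasure T
      = ∫⁻ s in Iic (t : ℝ), ENNReal.ofReal (Real.exp (a * s))
          ∂(timeMeasure T).map Subtype.val :=
        (setLIntegral_map measurableSet_Iic hm measurable_subtype_coe).symm
    _ ≤ ∫⁻ s in Iic (t : ℝ), ENNReal.ofReal (Real.exp (a * s)) := by
        rw [timeMeasure, map_comap_subtype_coe measurableSet_Icc]
        exact lintegral_mono' (Measure.restrict_mono le_rfl Measure.restrict_le_self) le_rfl
    _ = ENNReal.ofReal (Real.exp (a * t) / a) := by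
        rw [← integral_exp_mul_Iic ha, ofReal_integral_eq_lintegral_ofReal
          (integrableOn_exp_mul_Iic ha _) (ae_of_all _ fun _ => (Real.exp_pos _).le)]

lemma mul_lintegral_expWeight_le {T : ℝ} (c : ℝ≥0) (t : Icc (0 : ℝ) T) :
    c * ∫⁻ s in Iic t, expWeight c s ∂timeMeasure T ≤ 2⁻¹ * expWeight c t := by
  have ha : (0 : ℝ) < 2 * (c + 1) := by positivity
  refine (mul_le_mul_right (lintegral_exp_timeMeasure_le ha t) _).trans ?_
  change _ ≤ 2⁻¹ * ENNReal.ofReal (Real.exp (2 * (c + 1) * t))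
  have h2 : (2⁻¹ : ℝ≥0∞) = ENNReal.ofReal 2⁻¹ := by
    rw [ENNReal.ofReal_inv_of_pos two_pos]; simp
  rw [← ENNReal.ofReal_coe_nnreal (p := c), h2, ← ENNReal.ofReal_mul c.coe_nonneg,
    ← ENNReal.ofReal_mul (by norm_num)]
  refine ENNReal.ofReal_le_ofReal ?_
  rw [← mul_div_assoc, div_le_iff₀ ha]
  nlinarith [Real.exp_pos (2 * (c + 1) * (t : ℝ)), c.2]

/-- The constant in Grönwall's inequality. -/
noncomputable def gronwallConst (c : ℝ≥0) (T : ℝ) : ℝ≥0 := 2 * expWeight c T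

/-- **Grönwall's inequality** for lower Lebesgue integrals; no measurability is needed. -/
lemma le_of_le_add_lintegral {T : ℝ} {c : ℝ≥0} {φ A : Icc (0 : ℝ) T → ℝ≥0∞} {M : ℝ≥0∞}
    (hA : Monotone A) (hM : M ≠ ∞) (hφM : ∀ t, φ t ≤ M)
    (hφ : ∀ t, φ t ≤ A t + c * ∫⁻ s in Iic t, φ s ∂timeMeasure T) (t : Icc (0 : ℝ) T) :
    φ t ≤ gronwallConst c T * A t := by
  have hw : ∀ s : Icc (0 : ℝ) T, (1 : ℝ≥0∞) ≤ expWeight c s := fun s => by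
    exact_mod_cast one_le_expWeight c s.2.1
  -- Inserting a bound `(2 A + M') * expWeight` into the hypothesis halves `M'`.
  have key : ∀ n : ℕ, ∀ s ≤ t, φ s ≤ (2 * A t + M * 2⁻¹ ^ n) * expWeight c s := by
    intro n
    induction n with
    | zero =>
      intro s _
      calc φ s ≤ M * 1 := by simpa using hφM s
        _ ≤ (2 * A t + M * 2⁻¹ ^ 0) * expWeight c s := by
          gcongr
          · simp
          · exact hw s
    | succ n ih =>
      intro s hs
      calc φ s ≤ A s + c * ∫⁻ r in Iic s, φ r ∂timeMeasure T := hφ s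
        _ ≤ A t + c * ∫⁻ r in Iic s, (2 * A t + M * 2⁻¹ ^ n) * expWeight c r ∂timeMeasure T := by
          gcongr ?_ + c * ?_
          · exact hA hs
          · exact setLIntegral_mono' measurableSet_Iic fun r hr => ih r (le_trans hr hs)
        _ = A t + (2 * A t + M * 2⁻¹ ^ n) *
              (c * ∫⁻ r in Iic s, expWeight c r ∂timeMeasure T) := by
          rw [lintegral_const_mul _ (by unfold expWeight; fun_prop)]
          ring
        _ ≤ A t * expWeight c s + (2 * A t + M * 2⁻¹ ^ n) * (2⁻¹ * expWeight c s) := by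
          gcongr ?_ + _ * ?_
          · exact le_mul_of_one_le_right' (hw s)
          · exact mul_lintegral_expWeight_le c s
        _ = (A t + 2 * 2⁻¹ * A t + M * 2⁻¹ ^ (n + 1)) * expWeight c s := by ring
        _ = (2 * A t + M * 2⁻¹ ^ (n + 1)) * expWeight c s := by
          rw [ENNReal.mul_inv_cancel two_ne_zero ENNReal.ofNat_ne_top]; ring
  have hlim : Filter.Tendsto (fun n : ℕ => (2 * A t + M * 2⁻¹ ^ n) * (expWeight c t : ℝ≥0∞))
      Filter.atTop (nhds ((2 * A t + M * 0) * expWeight c t)) := by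
    refine ENNReal.Tendsto.mul_const (tendsto_const_nhds.add ?_) (.inr ENNReal.coe_ne_top)
    exact ENNReal.Tendsto.const_mul
      (ENNReal.tendsto_pow_atTop_nhds_zero_of_lt_one (by simp)) (.inr hM)
  calc φ t ≤ (2 * A t + M * 0) * expWeight c t :=
        ge_of_tendsto' hlim fun n => key n t le_rfl
    _ ≤ 2 * A t * expWeight c T := by
        rw [mul_zero, add_zero]
        gcongr
        exact expWeight_mono c t.2.2
    _ = gronwallConst c T * A t := by
        rw [gronwallConst]; push_cast; ring

/-- **Fixed points of Volterra type maps.** `g x y t` measures the distance of `x` and `y` at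
time `t`; if `Ψ` is Lipschitz with respect to the time integral of `g`, then an iterate of `Ψ` is a
contraction and `Ψ` has a fixed point. -/
lemma exists_fixedPoint_of_volterra {M : Type*} [MetricSpace M] [CompleteSpace M] [Nonempty M]
    {T : ℝ} {c : ℝ≥0} (Ψ : M → M) (g : M → M → Icc (0 : ℝ) T → ℝ≥0∞)
    (hg : ∀ x y t, g x y t ≤ edist x y)
    (hgΨ : ∀ x y t, g (Ψ x) (Ψ y) t ≤ c * ∫⁻ s in Iic t, g x y s ∂timeMeasure T)
    (hΨ : ∀ x y, edist (Ψ x) (Ψ y) ≤ c * ∫⁻ s, g x y s ∂timeMeasure T) :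
    ∃ x, Ψ x = x := by
  have hiter : ∀ (n : ℕ) x y t,
      g (Ψ^[n] x) (Ψ^[n] y) t ≤ 2⁻¹ ^ n * edist x y * expWeight c t := by
    intro n
    induction n with
    | zero =>
      intro x y t
      simp only [Function.iterate_zero, id, pow_zero, one_mul]
      refine (hg x y t).trans (le_mul_of_one_le_right' ?_)
      exact_mod_cast one_le_expWeight c t.2.1
    | succ n ih =>
      intro x y t
      simp only [Function.iterate_succ_apply']
      calc g (Ψ (Ψ^[n] x)) (Ψ (Ψ^[n] y)) t
          ≤ c * ∫⁻ s in Iic t, 2⁻¹ ^ n * edist x y * expWeight c s ∂timeMeasure T :=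
            (hgΨ _ _ t).trans (by gcongr; exact ih x y _)
        _ = 2⁻¹ ^ n * edist x y * (c * ∫⁻ s in Iic t, expWeight c s ∂timeMeasure T) := by
            rw [lintegral_const_mul _ (by unfold expWeight; fun_prop)]
            ring
        _ ≤ 2⁻¹ ^ n * edist x y * (2⁻¹ * expWeight c t) := by
            gcongr _ * ?_
            exact mul_lintegral_expWeight_le c t
        _ = 2⁻¹ ^ (n + 1) * edist x y * expWeight c t := by ring
  set D : ℝ≥0 := c * (expWeight c T * (timeMeasure T univ).toNNReal) with hD
  have hiter' : ∀ (n : ℕ) x y, edist (Ψ^[n + 1] x) (Ψ^[n + 1] y) ≤ D * 2⁻¹ ^ n * edist x y := by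
    intro n x y
    simp only [Function.iterate_succ_apply']
    calc edist (Ψ (Ψ^[n] x)) (Ψ (Ψ^[n] y))
        ≤ c * ∫⁻ s, 2⁻¹ ^ n * edist x y * expWeight c T ∂timeMeasure T := by
          refine (hΨ _ _).trans ?_
          gcongr with s
          refine (hiter n x y s).trans ?_
          gcongr
          exact expWeight_mono c s.2.2
      _ = D * 2⁻¹ ^ n * edist x y := by
          rw [lintegral_const, hD]
          push_cast
          rw [ENNReal.coe_toNNReal (measure_ne_top _ _)]
          ring
  obtain ⟨n, hn⟩ : ∃ n : ℕ, D * (2⁻¹ : ℝ≥0) ^ n < 1 := by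
    have : Filter.Tendsto (fun n : ℕ => D * (2⁻¹ : ℝ≥0) ^ n) Filter.atTop (nhds (D * 0)) :=
      Filter.Tendsto.const_mul D (NNReal.tendsto_pow_atTop_nhds_zero_of_lt_one
        (by rw [← NNReal.coe_lt_coe]; norm_num))
    rw [mul_zero] at this
    exact (this.eventually (gt_mem_nhds one_pos)).exists
  have hc : ContractingWith (D * (2⁻¹ : ℝ≥0) ^ n) Ψ^[n + 1] := by
    refine ⟨hn, fun x y => (hiter' n x y).trans_eq ?_⟩
    push_cast [ENNReal.coe_inv two_ne_zero]
    rfl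
  exact ⟨_, hc.isFixedPt_fixedPoint_iterate⟩

lemma continuous_setIntegral_Iic_timeMeasure {T : ℝ} {E : Type*} [NormedAddCommGroup E]
    [NormedSpace ℝ E] {f : Icc (0 : ℝ) T → E} (hf : Integrable f (timeMeasure T)) :
    Continuous fun t => ∫ s in Iic t, f s ∂timeMeasure T := by
  simp_rw [← integral_indicator measurableSet_Iic]
  refine continuous_iff_continuousAt.2 fun t₀ => ?_
  refine continuousAt_of_dominated (bound := fun s => ‖f s‖)
    (.of_forall fun t => hf.aestronglyMeasurable.indicator measurableSet_Iic)
    (.of_forall fun t => ae_of_all _ fun s => norm_indicator_le_norm_self _ _) hf.norm ?_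
  have : ∀ᵐ s ∂timeMeasure T, s ≠ t₀ := by
    simp [ae_iff, measure_singleton]
  filter_upwards [this] with s hs
  rcases lt_or_gt_of_ne hs with h | h
  · refine ContinuousAt.congr (f := fun _ => f s) continuousAt_const ?_
    filter_upwards [lt_mem_nhds h] with t ht
    rw [indicator_of_mem (mem_Iic.2 ht.le)]
  · refine ContinuousAt.congr (f := fun _ => 0) continuousAt_const ?_
    filter_upwards [gt_mem_nhds h] with t ht
    rw [indicator_of_notMem (by simpa using ht)]

lemma PathSpace.edist_le {d : ℕ} {T : ℝ} {x y : PathSpace d T} {C : ℝ≥0∞}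
    (h : ∀ t, edist (x t) (y t) ≤ C) : edist x y ≤ C := by
  induction C with
  | top => exact le_top
  | coe C =>
    rw [edist_dist, ENNReal.ofReal_le_iff_le_toReal ENNReal.coe_ne_top,
      ContinuousMap.dist_le (by simp)]
    intro t
    have := h t
    rwa [edist_dist, ENNReal.ofReal_le_iff_le_toReal ENNReal.coe_ne_top] at this

lemma PathSpace.edist_apply_le {d : ℕ} {T : ℝ} (x y : PathSpace d T) (t : Icc (0 : ℝ) T) :
    edist (x t) (y t) ≤ edist x y := by
  rw [edist_dist, edist_dist]
  exact ENNReal.ofReal_le_ofReal (ContinuousMap.dist_apply_le_dist t)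

/-! ### The Wasserstein distance of the laws of random variables -/

lemma wasserstein_rpow {E : Type*} [MeasurableSpace E] [PseudoEMetricSpace E] {p : ℝ} (hp : 0 < p)
    (μ ν : Measure E) : wasserstein p μ ν ^ p =
      ⨅ (m : Measure (E × E)) (_ : IsCoupling m μ ν), ∫⁻ z, edist z.1 z.2 ^ p ∂m := by
  rw [wasserstein, ← ENNReal.rpow_mul, one_div_mul_cancel hp.ne', ENNReal.rpow_one]

lemma wasserstein_map_le {E : Type*} [MeasurableSpace E] [PseudoEMetricSpace E]
    [OpensMeasurableSpace E] [SecondCountableTopology E] {p : ℝ} (hp : 0 ≤ p)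
    {Ω : Type*} [MeasurableSpace Ω] (P : Measure Ω) {X Y : Ω → E}
    (hX : Measurable X) (hY : Measurable Y) :
    wasserstein p (P.map X) (P.map Y) ≤ (∫⁻ ω, edist (X ω) (Y ω) ^ p ∂P) ^ (1 / p) := by
  have hXY : Measurable fun ω => (X ω, Y ω) := hX.prodMk hY
  refine ENNReal.rpow_le_rpow ?_ (by positivity)
  have hc : IsCoupling (P.map fun ω => (X ω, Y ω)) (P.map X) (P.map Y) :=
    ⟨Measure.map_map measurable_fst hXY, Measure.map_map measurable_snd hXY⟩
  rw [← lintegral_map (f := fun z : E × E => edist z.1 z.2 ^ p)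
    (measurable_edist.pow_const p) hXY]
  exact iInf₂_le_of_le _ hc le_rfl

lemma wasserstein_self {E : Type*} [MeasurableSpace E] [PseudoEMetricSpace E]
    [OpensMeasurableSpace E] [SecondCountableTopology E] {p : ℝ} (hp : 0 < p) (μ : Measure E) :
    wasserstein p μ μ = 0 := by
  have h := wasserstein_map_le hp.le μ (measurable_id (α := E)) (measurable_id (α := E))
  simpa [ENNReal.zero_rpow_of_pos hp, hp, Measure.map_id] using h

lemma lintegral_rpow_le_of_ae_le {Ω : Type*} [MeasurableSpace Ω] {P : Measure Ω}
    [IsProbabilityMeasure P] {p : ℝ} (hp : 0 < p) {f : Ω → ℝ≥0∞} {C : ℝ≥0∞}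
    (h : ∀ᵐ ω ∂P, f ω ≤ C) : (∫⁻ ω, f ω ^ p ∂P) ^ (1 / p) ≤ C := by
  calc (∫⁻ ω, f ω ^ p ∂P) ^ (1 / p) ≤ (∫⁻ _, C ^ p ∂P) ^ (1 / p) := by
        gcongr ?_ ^ _
        refine lintegral_mono_ae (h.mono fun ω hω => ?_)
        gcongr
    _ = C := by
        rw [lintegral_const, measure_univ, mul_one, ← ENNReal.rpow_mul,
          mul_one_div_cancel hp.ne', ENNReal.rpow_one]

/-- Minkowski's inequality with a constant summand. -/
lemma lintegral_rpow_le_of_ae_le_mul_add {Ω : Type*} [MeasurableSpace Ω] {P : Measure Ω}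
    [IsProbabilityMeasure P] {p : ℝ} (hp : 1 ≤ p) {f H : Ω → ℝ≥0∞} (hH : Measurable H)
    {A I : ℝ≥0∞} (h : ∀ᵐ ω ∂P, f ω ≤ A * H ω + I) :
    (∫⁻ ω, f ω ^ p ∂P) ^ (1 / p) ≤ A * (∫⁻ ω, H ω ^ p ∂P) ^ (1 / p) + I := by
  have h0 : 0 < p := one_pos.trans_le hp
  calc (∫⁻ ω, f ω ^ p ∂P) ^ (1 / p)
      ≤ (∫⁻ ω, ((fun ω => A * H ω) + fun _ => I : Ω → ℝ≥0∞) ω ^ p ∂P) ^ (1 / p) := by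
        gcongr ?_ ^ _
        refine lintegral_mono_ae (h.mono fun ω hω => ?_)
        gcongr
        exact hω
    _ ≤ (∫⁻ ω, (A * H ω) ^ p ∂P) ^ (1 / p) + (∫⁻ _, I ^ p ∂P) ^ (1 / p) :=
        ENNReal.lintegral_Lp_add_le (hH.const_mul _).aemeasurable aemeasurable_const hp
    _ ≤ A * (∫⁻ ω, H ω ^ p ∂P) ^ (1 / p) + I := by
        gcongr
        · simp_rw [ENNReal.mul_rpow_of_nonneg _ _ h0.le]
          rw [lintegral_const_mul _ (hH.pow_const p),
            ENNReal.mul_rpow_of_nonneg _ _ (by positivity), ← ENNReal.rpow_mul,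
            mul_one_div_cancel h0.ne', ENNReal.rpow_one]
        · exact lintegral_rpow_le_of_ae_le h0 (ae_of_all _ fun _ => le_rfl)

lemma wasserstein_le_add_moment {E : Type*} [NormedAddCommGroup E] [MeasurableSpace E]
    [BorelSpace E] [SecondCountableTopology E] {p : ℝ} (hp : 1 ≤ p) (μ ν : ProbMoment E p) :
    wasserstein p μ.toMeasure ν.toMeasure ≤
      (∫⁻ x, ‖x‖ₑ ^ p ∂μ.toMeasure) ^ (1 / p) + (∫⁻ x, ‖x‖ₑ ^ p ∂ν.toMeasure) ^ (1 / p) := by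
  have := μ.isProb
  have := ν.isProb
  have hm : Measurable fun x : E => ‖x‖ₑ ^ p := by fun_prop
  set π := μ.toMeasure.prod ν.toMeasure
  have h1 : π.map Prod.fst = μ.toMeasure := by simp [π, Measure.map_fst_prod]
  have h2 : π.map Prod.snd = ν.toMeasure := by simp [π, Measure.map_snd_prod]
  have h0 : (0 : ℝ) ≤ p := zero_le_one.trans hp
  calc wasserstein p μ.toMeasure ν.toMeasure
      = wasserstein p (π.map Prod.fst) (π.map Prod.snd) := by rw [h1, h2]
    _ ≤ (∫⁻ z, edist z.1 z.2 ^ p ∂π) ^ (1 / p) :=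
        wasserstein_map_le h0 π measurable_fst measurable_snd
    _ ≤ (∫⁻ z, ((fun z : E × E => ‖z.1‖ₑ) + fun z : E × E => ‖z.2‖ₑ) z ^ p ∂π) ^ (1 / p) := by
        gcongr with z
        simpa [edist_zero_right] using edist_triangle_right z.1 z.2 0
    _ ≤ (∫⁻ z, ‖z.1‖ₑ ^ p ∂π) ^ (1 / p) + (∫⁻ z, ‖z.2‖ₑ ^ p ∂π) ^ (1 / p) :=
        ENNReal.lintegral_Lp_add_le (by fun_prop) (by fun_prop) hp
    _ = _ := by
        rw [← lintegral_map hm measurable_fst, ← lintegral_map hm measurable_snd, h1, h2]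

/-! ### Empirical measures -/

lemma map_empiricalMeasure {E F : Type*} [MeasurableSpace E] [MeasurableSpace F] {N : ℕ}
    (y : Fin N → E) {f : E → F} (hf : Measurable f) :
    (empiricalMeasure y).map f = empiricalMeasure fun i => f (y i) := by
  simp only [empiricalMeasure, Measure.map_smul]
  rw [← Measure.mapₗ_apply_of_measurable hf, map_sum]
  simp [Measure.mapₗ_apply_of_measurable hf, Measure.map_dirac' hf]

instance instIsProbabilityMeasureEmpiricalMeasure {E : Type*} [MeasurableSpace E] {N : ℕ} [NeZero N]
    (y : Fin N → E) : IsProbabilityMeasure (empiricalMeasure y) := ⟨by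
  simp [empiricalMeasure, ENNReal.inv_mul_cancel (Nat.cast_ne_zero.2 (NeZero.ne N))
    (ENNReal.natCast_ne_top N)]⟩

/-- The uniform measure on the set of particles. A random variable on this probability space is a
vector, and its law is the empirical measure of the vector. -/
noncomputable abbrev uniformIndex (N : ℕ) : Measure (Fin N) := empiricalMeasure id

lemma map_uniformIndex {E : Type*} [MeasurableSpace E] {N : ℕ} (y : Fin N → E) :
    (uniformIndex N).map y = empiricalMeasure y :=
  map_empiricalMeasure id (measurable_of_countable y)

lemma ae_uniformIndex {N : ℕ} {q : Fin N → Prop} :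
    (∀ᵐ i ∂uniformIndex N, q i) ↔ ∀ i, q i := by
  refine ⟨fun h i => ?_, fun h => ae_of_all _ h⟩
  by_contra hi
  have h0 : uniformIndex N {j | ¬ q j} = 0 := h
  simp only [empiricalMeasure, Measure.smul_apply, Measure.finsetSum_apply, smul_eq_mul, id,
    mul_eq_zero, ENNReal.inv_eq_zero, ENNReal.natCast_ne_top, false_or,
    Finset.sum_eq_zero_iff] at h0
  simpa [hi] using h0 i (Finset.mem_univ i)

/-! ### Flows of marginal laws -/

lemma memLp_ofReal_iff_lintegral {E : Type*} [NormedAddCommGroup E] {Ω : Type*} [MeasurableSpace Ω]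
    {P : Measure Ω} {p : ℝ} (hp : 0 < p) {X : Ω → E} (hX : AEStronglyMeasurable X P) :
    MemLp X (ENNReal.ofReal p) P ↔ ∫⁻ ω, ‖X ω‖ₑ ^ p ∂P < ∞ := by
  rw [MemLp, eLpNorm_lt_top_iff_lintegral_rpow_enorm_lt_top (by simpa using hp)
    ENNReal.ofReal_ne_top, ENNReal.toReal_ofReal hp.le]
  exact and_iff_right hX

lemma PathSpace.enorm_apply_le {d : ℕ} {T : ℝ} (x : PathSpace d T) (t : Icc (0 : ℝ) T) :
    ‖x t‖ₑ ≤ ‖x‖ₑ := by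
  rw [← edist_zero_right, ← edist_zero_right]
  exact PathSpace.edist_apply_le x 0 t

lemma PathSpace.measurable_eval {d : ℕ} {T : ℝ} (t : Icc (0 : ℝ) T) :
    Measurable fun x : PathSpace d T => x t :=
  (continuous_eval_const t).measurable

/-- `μ t` is the law of `X t` under `P`, for all times `t`. -/
def IsLawFlow {d : ℕ} {T p : ℝ} {Ω : Type*} [MeasurableSpace Ω] (P : Measure Ω)
    (X : Ω → PathSpace d T) (μ : Icc (0 : ℝ) T → ProbMoment (State d) p) : Prop :=
  ∀ t, (μ t).toMeasure = P.map fun ω => X ω t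

lemma exists_isLawFlow {d : ℕ} {T p : ℝ} (hp : 1 ≤ p) {Ω : Type*} [MeasurableSpace Ω]
    (P : Measure Ω) [IsProbabilityMeasure P] {X : Ω → PathSpace d T} (hX : Measurable X)
    (hXp : MemLp X (ENNReal.ofReal p) P) :
    ∃ μ : Icc (0 : ℝ) T → ProbMoment (State d) p, IsLawFlow P X μ := by
  have hXt : ∀ t, Measurable fun ω => X ω t := fun t => (PathSpace.measurable_eval t).comp hX
  have h0 : 0 < p := one_pos.trans_le hp
  refine ⟨fun t => ⟨P.map fun ω => X ω t, Measure.isProbabilityMeasure_map (hXt t).aemeasurable,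
    ?_⟩, fun t => rfl⟩
  rw [lintegral_map (by fun_prop) (hXt t)]
  refine (lintegral_mono fun ω => ?_).trans_lt
    ((memLp_ofReal_iff_lintegral h0 hXp.1).1 hXp)
  gcongr
  exact PathSpace.enorm_apply_le _ _

namespace IsLawFlow

variable {d : ℕ} {T p : ℝ} {Ω : Type*} [MeasurableSpace Ω] {P : Measure Ω}
  {X Y : Ω → PathSpace d T} {μ ν : Icc (0 : ℝ) T → ProbMoment (State d) p}

lemma wasserstein_le (hp : 1 ≤ p) (hX : Measurable X) (hY : Measurable Y)
    (hμ : IsLawFlow P X μ) (hν : IsLawFlow P Y ν) (s t : Icc (0 : ℝ) T) :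
    wasserstein p (μ s).toMeasure (ν t).toMeasure ≤
      (∫⁻ ω, edist (X ω s) (Y ω t) ^ p ∂P) ^ (1 / p) := by
  rw [hμ s, hν t]
  exact wasserstein_map_le (zero_le_one.trans hp) P ((PathSpace.measurable_eval s).comp hX)
    ((PathSpace.measurable_eval t).comp hY)

lemma moment_le (hp : 1 ≤ p) (hX : Measurable X) (hμ : IsLawFlow P X μ) (t : Icc (0 : ℝ) T) :
    ∫⁻ x, ‖x‖ₑ ^ p ∂(μ t).toMeasure ≤ ∫⁻ ω, ‖X ω‖ₑ ^ p ∂P := by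
  have hXt : Measurable fun ω => X ω t := (PathSpace.measurable_eval t).comp hX
  rw [hμ t, lintegral_map (by fun_prop) hXt]
  refine lintegral_mono fun ω => ?_
  gcongr
  exact PathSpace.enorm_apply_le _ _

/-- By dominated convergence, the marginal laws of a `p`-integrable random path depend continuously
on time, with respect to the Wasserstein distance. -/
lemma continuous (hp : 1 ≤ p) (hX : Measurable X) (hXp : MemLp X (ENNReal.ofReal p) P)
    (hμ : IsLawFlow P X μ) : Continuous μ := by
  have h0 : 0 < p := one_pos.trans_le hp
  have hXt : ∀ t, Measurable fun ω => X ω t := fun t => (PathSpace.measurable_eval t).comp hX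
  have hlim : ∀ t₀, Filter.Tendsto
      (fun t => (∫⁻ ω, edist (X ω t₀) (X ω t) ^ p ∂P) ^ (1 / p)) (nhds t₀) (nhds 0) := by
    intro t₀
    have h : Filter.Tendsto (fun t => ∫⁻ ω, edist (X ω t₀) (X ω t) ^ p ∂P) (nhds t₀)
        (nhds (∫⁻ _, 0 ∂P)) := by
      refine tendsto_lintegral_filter_of_dominated_convergence
        (fun ω => 2 ^ p * ‖X ω‖ₑ ^ p) (.of_forall fun t => ?_)
        (.of_forall fun t => ae_of_all _ fun ω => ?_) ?_ (ae_of_all _ fun ω => ?_)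
      · exact ((hXt t₀).edist (hXt t)).pow_const p
      · rw [← ENNReal.mul_rpow_of_nonneg _ _ h0.le, two_mul]
        gcongr
        refine (edist_triangle_right _ _ 0).trans ?_
        rw [edist_zero_right, edist_zero_right]
        exact add_le_add (PathSpace.enorm_apply_le _ _) (PathSpace.enorm_apply_le _ _)
      · rw [lintegral_const_mul _ (by fun_prop)]
        exact ENNReal.mul_ne_top (ENNReal.rpow_ne_top_of_nonneg h0.le ENNReal.ofNat_ne_top)
          ((memLp_ofReal_iff_lintegral h0 hXp.1).1 hXp).ne
      · have hc : Continuous fun t => edist (X ω t₀) (X ω t) ^ p :=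
          (ENNReal.continuous_rpow_const).comp (continuous_const.edist (X ω).continuous)
        simpa [ENNReal.zero_rpow_of_pos h0] using hc.tendsto t₀
    have h' := (ENNReal.continuous_rpow_const (y := 1 / p)).tendsto _ |>.comp h
    simpa [ENNReal.zero_rpow_of_pos (inv_pos.2 h0), Function.comp_def] using h'
  refine continuous_def.2 fun U hU => isOpen_iff_mem_nhds.2 fun t₀ ht₀ => ?_
  obtain ⟨ε, hε, h⟩ := hU (μ t₀) ht₀
  filter_upwards [(hlim t₀).eventually (gt_mem_nhds hε)] with t ht
  exact h _ ((wasserstein_le hp hX hX hμ hμ t₀ t).trans_lt ht)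

end IsLawFlow

/-! ### The drift along a flow of measures -/

lemma DriftAssumption.edist_le {d : ℕ} {T p : ℝ} {K : ℝ≥0} {b : Drift d T p}
    (hb : DriftAssumption K b) (hp : 1 ≤ p) (t : Icc (0 : ℝ) T) (x x' : State d)
    (μ μ' : ProbMoment (State d) p) :
    edist (b t x μ) (b t x' μ') ≤
      (K ^ (1 / p) : ℝ≥0) * (edist x x' + wasserstein p μ.toMeasure μ'.toMeasure) := by
  have h0 : 0 < p := one_pos.trans_le hp
  have h1 : 0 ≤ 1 / p := by positivity
  calc edist (b t x μ) (b t x' μ') = (edist (b t x μ) (b t x' μ') ^ p) ^ (1 / p) := by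
        rw [← ENNReal.rpow_mul, mul_one_div_cancel h0.ne', ENNReal.rpow_one]
    _ ≤ (K * (edist x x' ^ p + wasserstein p μ.toMeasure μ'.toMeasure ^ p)) ^ (1 / p) := by
        gcongr
        exact hb.lipschitz t x x' μ μ'
    _ ≤ _ := by
        rw [ENNReal.mul_rpow_of_nonneg _ _ h1, ENNReal.coe_rpow_of_nonneg _ h1]
        gcongr
        exact ENNReal.rpow_add_rpow_le_add _ _ hp

/-- Along the flow `μ` the drift is integrable on every continuous path. -/
def IsAdmissibleFlow {d : ℕ} {T p : ℝ} (b : Drift d T p)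
    (μ : Icc (0 : ℝ) T → ProbMoment (State d) p) : Prop :=
  ∀ x : PathSpace d T, Integrable (fun s => b s (x s) (μ s)) (timeMeasure T)

lemma IsLawFlow.isAdmissibleFlow {d : ℕ} {T p : ℝ} {K : ℝ≥0} {b : Drift d T p}
    (hb : DriftAssumption K b) (hp : 1 ≤ p) {Ω : Type*} [MeasurableSpace Ω] {P : Measure Ω}
    {X : Ω → PathSpace d T} {μ : Icc (0 : ℝ) T → ProbMoment (State d) p}
    (hX : Measurable X) (hXp : MemLp X (ENNReal.ofReal p) P) (hμ : IsLawFlow P X μ) :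
    IsAdmissibleFlow b μ := by
  intro x
  have h0 : 0 < p := one_pos.trans_le hp
  obtain ⟨x₁, μ₁, hint⟩ := hb.integrable
  have : BorelSpace (ProbMoment (State d) p) := ⟨rfl⟩
  have hpair : Measurable fun s => (s, x s, μ s) :=
    measurable_id.prodMk (x.continuous.measurable.prodMk
      (hμ.continuous hp hX hXp).measurable)
  have hmeas : Measurable fun s => b s (x s) (μ s) := hb.measurable.comp hpair
  set M : ℝ≥0∞ := edist x (ContinuousMap.const _ x₁) + ((∫⁻ ω, ‖X ω‖ₑ ^ p ∂P) ^ (1 / p) +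
    (∫⁻ y, ‖y‖ₑ ^ p ∂μ₁.toMeasure) ^ (1 / p)) with hM
  have hMtop : M < ∞ := by
    refine ENNReal.add_lt_top.2 ⟨edist_lt_top _ _, ENNReal.add_lt_top.2 ⟨?_, ?_⟩⟩
    · exact ENNReal.rpow_lt_top_of_nonneg (by positivity)
        ((memLp_ofReal_iff_lintegral h0 hXp.1).1 hXp).ne
    · exact ENNReal.rpow_lt_top_of_nonneg (by positivity) μ₁.moment_lt_top.ne
  have hdiff : Integrable (fun s => b s (x s) (μ s) - b s x₁ μ₁) (timeMeasure T) := by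
    refine ⟨hmeas.aestronglyMeasurable.sub hint.1, ?_⟩
    rw [hasFiniteIntegral_iff_enorm]
    calc ∫⁻ s, ‖b s (x s) (μ s) - b s x₁ μ₁‖ₑ ∂timeMeasure T
        ≤ ∫⁻ _, (K ^ (1 / p) : ℝ≥0) * M ∂timeMeasure T := by
          refine lintegral_mono fun s => ?_
          rw [← edist_eq_enorm_sub]
          refine (hb.edist_le hp s _ _ _ _).trans ?_
          rw [hM]
          gcongr
          · exact PathSpace.edist_apply_le x (ContinuousMap.const _ x₁) s
          · refine (wasserstein_le_add_moment hp _ _).trans ?_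
            gcongr
            exact hμ.moment_le hp hX s
      _ < ∞ := by
          rw [lintegral_const]
          exact ENNReal.mul_lt_top (ENNReal.mul_lt_top ENNReal.coe_lt_top hMtop)
            (measure_lt_top _ _)
  simpa [Pi.add_def] using hdiff.add hint

/-! ### The integral equation along a fixed flow of measures -/

section FixedFlow

variable {d : ℕ} {T p : ℝ} {K : ℝ≥0} {b : Drift d T p}

lemma DriftAssumption.edist_integral_le (hb : DriftAssumption K b) (hp : 1 ≤ p)
    {μ ν : Icc (0 : ℝ) T → ProbMoment (State d) p} {x y : PathSpace d T}
    (hx : Integrable (fun s => b s (x s) (μ s)) (timeMeasure T))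
    (hy : Integrable (fun s => b s (y s) (ν s)) (timeMeasure T)) (t : Icc (0 : ℝ) T) :
    edist (∫ s in Iic t, b s (x s) (μ s) ∂timeMeasure T)
        (∫ s in Iic t, b s (y s) (ν s) ∂timeMeasure T) ≤
      (K ^ (1 / p) : ℝ≥0) * (∫⁻ s in Iic t, edist (x s) (y s) ∂timeMeasure T) +
        (K ^ (1 / p) : ℝ≥0) *
          ∫⁻ s in Iic t, wasserstein p (μ s).toMeasure (ν s).toMeasure ∂timeMeasure T := by
  have hm : Measurable fun s => edist (x s) (y s) := by fun_prop
  rw [edist_eq_enorm_sub, ← integral_sub hx.integrableOn hy.integrableOn, ← mul_add,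
    ← lintegral_add_left hm, ← lintegral_const_mul' _ _ ENNReal.coe_ne_top]
  refine (enorm_integral_le_lintegral_enorm _).trans (lintegral_mono fun s => ?_)
  rw [← edist_eq_enorm_sub]
  exact hb.edist_le hp s _ _ _ _

/-- Stability of the integral equation with respect to the initial value, the driving path and the
flow of measures. The flow enters only through the time integral of its Wasserstein distance. -/
lemma SolvesIntegralEq.edist_apply_le (hb : DriftAssumption K b) (hp : 1 ≤ p)
    {μ ν : Icc (0 : ℝ) T → ProbMoment (State d) p} {z z' : State d} {w w' x y : PathSpace d T}
    (hx : SolvesIntegralEq b μ z w x) (hy : SolvesIntegralEq b ν z' w' y) (t : Icc (0 : ℝ) T) :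
    edist (x t) (y t) ≤ gronwallConst (K ^ (1 / p)) T * (edist z z' + edist w w' +
      (K ^ (1 / p) : ℝ≥0) *
        ∫⁻ s in Iic t, wasserstein p (μ s).toMeasure (ν s).toMeasure ∂timeMeasure T) := by
  refine le_of_le_add_lintegral (φ := fun t => edist (x t) (y t))
    (A := fun t => edist z z' + edist w w' + (K ^ (1 / p) : ℝ≥0) *
        ∫⁻ s in Iic t, wasserstein p (μ s).toMeasure (ν s).toMeasure ∂timeMeasure T)
    (fun r s hrs => ?_) (edist_ne_top x y) (PathSpace.edist_apply_le x y) (fun s => ?_) t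
  · dsimp only
    gcongr
  · beta_reduce
    rw [hx.2 s, hy.2 s]
    calc _ ≤ edist z z' + edist (∫ s in Iic s, b s (x s) (μ s) ∂timeMeasure T)
          (∫ s in Iic s, b s (y s) (ν s) ∂timeMeasure T) + edist (w s) (w' s) :=
          (edist_add_add_le _ _ _ _).trans (by gcongr; exact edist_add_add_le _ _ _ _)
      _ ≤ edist z z' + _ + edist w w' :=
          add_le_add (add_le_add le_rfl (hb.edist_integral_le hp hx.1 hy.1 s))
            (PathSpace.edist_apply_le w w' s)
      _ = _ := by ring

lemma SolvesIntegralEq.edist_le_of_same_flow (hb : DriftAssumption K b) (hp : 1 ≤ p)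
    {μ : Icc (0 : ℝ) T → ProbMoment (State d) p} {e e' : State d × PathSpace d T}
    {x y : PathSpace d T} (hx : SolvesIntegralEq b μ e.1 e.2 x)
    (hy : SolvesIntegralEq b μ e'.1 e'.2 y) :
    edist x y ≤ (gronwallConst (K ^ (1 / p)) T * 2 : ℝ≥0) * edist e e' := by
  refine PathSpace.edist_le fun t => (hx.edist_apply_le hb hp hy t).trans ?_
  have h0 : ∀ s, wasserstein p (μ s).toMeasure (μ s).toMeasure = 0 := fun s =>
    wasserstein_self (one_pos.trans_le hp) _
  simp only [h0, lintegral_zero, mul_zero, add_zero]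
  push_cast
  rw [mul_assoc, two_mul]
  gcongr
  · exact le_max_left _ _
  · exact le_max_right _ _

lemma SolvesIntegralEq.eq_of_same_flow (hb : DriftAssumption K b) (hp : 1 ≤ p)
    {μ : Icc (0 : ℝ) T → ProbMoment (State d) p} {z : State d} {w x y : PathSpace d T}
    (hx : SolvesIntegralEq b μ z w x) (hy : SolvesIntegralEq b μ z w y) : x = y := by
  have h := SolvesIntegralEq.edist_le_of_same_flow hb hp (e := (z, w)) (e' := (z, w)) hx hy
  rwa [edist_self, mul_zero, nonpos_iff_eq_zero, edist_eq_zero] at h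

lemma IsAdmissibleFlow.exists_solvesIntegralEq (hb : DriftAssumption K b) (hp : 1 ≤ p)
    {μ : Icc (0 : ℝ) T → ProbMoment (State d) p} (hμ : IsAdmissibleFlow b μ)
    (z : State d) (w : PathSpace d T) : ∃ x, SolvesIntegralEq b μ z w x := by
  have h0 : ∀ s, wasserstein p (μ s).toMeasure (μ s).toMeasure = 0 := fun s =>
    wasserstein_self (one_pos.trans_le hp) _
  set Ψ : PathSpace d T → PathSpace d T := fun x =>
    ⟨fun t => z + (∫ s in Iic t, b s (x s) (μ s) ∂timeMeasure T) + w t,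
      (continuous_const.add (continuous_setIntegral_Iic_timeMeasure (hμ x))).add w.continuous⟩
    with hΨdef
  have hΨ : ∀ x y t, edist (Ψ x t) (Ψ y t) ≤
      (K ^ (1 / p) : ℝ≥0) * ∫⁻ s in Iic t, edist (x s) (y s) ∂timeMeasure T := by
    intro x y t
    have h := hb.edist_integral_le hp (hμ x) (hμ y) t
    simp only [h0, lintegral_zero, mul_zero, add_zero] at h
    simpa [hΨdef, edist_add_right, edist_add_left] using h
  obtain ⟨x, hx⟩ := exists_fixedPoint_of_volterra Ψ (fun x y t => edist (x t) (y t))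
    PathSpace.edist_apply_le hΨ fun x y => PathSpace.edist_le fun t =>
      (hΨ x y t).trans (mul_le_mul_right (setLIntegral_le_lintegral _ _) _)
  exact ⟨x, hμ x, fun t => (DFunLike.congr_fun hx t).symm⟩

/-- The solution map of the integral equation along an admissible flow of measures. It is Lipschitz
continuous, which makes its composition with random inputs measurable. -/
lemma IsAdmissibleFlow.exists_solutionMap (hb : DriftAssumption K b) (hp : 1 ≤ p)
    {μ : Icc (0 : ℝ) T → ProbMoment (State d) p} (hμ : IsAdmissibleFlow b μ) :
    ∃ F : State d × PathSpace d T → PathSpace d T,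
      LipschitzWith (gronwallConst (K ^ (1 / p)) T * 2) F ∧
      ∀ e, SolvesIntegralEq b μ e.1 e.2 (F e) := by
  choose F hF using fun e : State d × PathSpace d T => hμ.exists_solvesIntegralEq hb hp e.1 e.2
  exact ⟨F, fun e e' => (hF e).edist_le_of_same_flow hb hp (hF e'), hF⟩

end FixedFlow

/-! ### McKean-Vlasov equations -/

lemma memLp_of_edist_le {E F Ω : Type*} [NormedAddCommGroup E] [NormedAddCommGroup F]
    [MeasurableSpace Ω] {P : Measure Ω} [IsFiniteMeasure P] {q : ℝ≥0∞} {f : Ω → E} {g : Ω → F}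
    (hf : AEStronglyMeasurable f P) (hg : MemLp g q P) (a : E) (e : F) (C : ℝ≥0)
    (h : ∀ᵐ ω ∂P, edist (f ω) a ≤ C * edist (g ω) e) : MemLp f q P := by
  have hfa : MemLp (fun ω => f ω - a) q P := by
    refine (hg.sub (memLp_const e)).of_le_mul (c := C) (hf.sub aestronglyMeasurable_const)
      (h.mono fun ω hω => ?_)
    rw [edist_dist, edist_dist, ← ENNReal.ofReal_coe_nnreal, ← ENNReal.ofReal_mul C.coe_nonneg,
      ENNReal.ofReal_le_ofReal_iff (by positivity), dist_eq_norm, dist_eq_norm] at hω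
    exact hω
  simpa [Pi.add_def] using hfa.add (memLp_const a)

lemma Lp_edist_eq {E Ω : Type*} [NormedAddCommGroup E] [MeasurableSpace Ω] {P : Measure Ω}
    {p : ℝ} (hp : 0 < p) (X Y : Lp E (ENNReal.ofReal p) P) :
    edist X Y = (∫⁻ ω, edist (X ω) (Y ω) ^ p ∂P) ^ (1 / p) := by
  rw [Lp.edist_def, eLpNorm_eq_lintegral_rpow_enorm_toReal (by simpa using hp)
    ENNReal.ofReal_ne_top, ENNReal.toReal_ofReal hp.le]
  simp [edist_eq_enorm_sub]

namespace IsMcKeanVlasovSolution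

variable {d : ℕ} {T p : ℝ} {K : ℝ≥0} {b : Drift d T p} {Ω : Type*} [MeasurableSpace Ω]
  {P : Measure Ω} [IsProbabilityMeasure P] {ζ ζ' : Ω → State d} {W W' X Y : Ω → PathSpace d T}

/-- A solution is `p`-integrable as soon as its input is, although only the marginals `X t` are
required to be so. Indeed, almost all paths solve the integral equation along the *same* flow, hence
the path of `ω` stays close to the path of one fixed `ω₀`. -/
lemma memLp (hb : DriftAssumption K b) (hp : 1 ≤ p)
    (he : MemLp (fun ω => (ζ ω, W ω)) (ENNReal.ofReal p) P)
    (hX : IsMcKeanVlasovSolution b P ζ W X) : MemLp X (ENNReal.ofReal p) P := by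
  obtain ⟨hXm, μ, -, hsol⟩ := hX
  obtain ⟨ω₀, hω₀⟩ := hsol.exists
  exact memLp_of_edist_le hXm.aestronglyMeasurable he (X ω₀) (ζ ω₀, W ω₀) _
    (hsol.mono fun ω hω => SolvesIntegralEq.edist_le_of_same_flow hb hp
      (e := (ζ ω, W ω)) (e' := (ζ ω₀, W ω₀)) hω hω₀)

/-- The paths of a solution are obtained from its input by the solution map along its flow of
laws. -/
lemma exists_solutionMap (hb : DriftAssumption K b) (hp : 1 ≤ p)
    (he : MemLp (fun ω => (ζ ω, W ω)) (ENNReal.ofReal p) P)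
    (hX : IsMcKeanVlasovSolution b P ζ W X) :
    ∃ (μ : Icc (0 : ℝ) T → ProbMoment (State d) p) (F : State d × PathSpace d T → PathSpace d T),
      Measurable F ∧ IsLawFlow P X μ ∧ (∀ e, SolvesIntegralEq b μ e.1 e.2 (F e)) ∧
      ∀ᵐ ω ∂P, X ω = F (ζ ω, W ω) := by
  have hXp := hX.memLp hb hp he
  obtain ⟨hXm, μ, hμ, hsol⟩ := hX
  obtain ⟨F, hF, hFsol⟩ := (IsLawFlow.isAdmissibleFlow hb hp hXm hXp hμ).exists_solutionMap hb hp
  exact ⟨μ, F, hF.continuous.measurable, hμ, hFsol,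
    hsol.mono fun ω hω => hω.eq_of_same_flow hb hp (hFsol (ζ ω, W ω))⟩

/-- **Stability of McKean-Vlasov equations** on one probability space. The constant does not depend
on the probability space. -/
lemma exists_edist_le (hb : DriftAssumption K b) (hp : 1 ≤ p) :
    ∃ C : ℝ≥0, ∀ {Ω : Type*} [MeasurableSpace Ω] {P : Measure Ω} [IsProbabilityMeasure P]
      {ζ ζ' : Ω → State d} {W W' X Y : Ω → PathSpace d T},
      Measurable (fun ω => (ζ ω, W ω)) → Measurable (fun ω => (ζ' ω, W' ω)) →
      MemLp (fun ω => (ζ ω, W ω)) (ENNReal.ofReal p) P →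
      MemLp (fun ω => (ζ' ω, W' ω)) (ENNReal.ofReal p) P →
      IsMcKeanVlasovSolution b P ζ W X → IsMcKeanVlasovSolution b P ζ' W' Y →
      ∀ᵐ ω ∂P, edist (X ω) (Y ω) ≤ C * (edist (ζ ω, W ω) (ζ' ω, W' ω) +
        (∫⁻ ω, edist (ζ ω, W ω) (ζ' ω, W' ω) ^ p ∂P) ^ (1 / p)) := by
  have h0 : 0 < p := one_pos.trans_le hp
  set L : ℝ≥0 := K ^ (1 / p)
  set G : ℝ≥0 := gronwallConst L T
  set G' : ℝ≥0 := gronwallConst (G * L) T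
  set V : ℝ≥0 := (timeMeasure T univ).toNNReal with hV
  refine ⟨2 * G + G * L * (G' * (2 * G) * V), ?_⟩
  intro Ω _ P _ ζ ζ' W W' X Y hem hem' he he' hX hY
  have hXp := hX.memLp hb hp he
  have hYp := hY.memLp hb hp he'
  obtain ⟨hXm, μ, hμ, hXsol⟩ := hX
  obtain ⟨hYm, ν, hν, hYsol⟩ := hY
  set H : Ω → ℝ≥0∞ := fun ω => edist (ζ ω, W ω) (ζ' ω, W' ω) with hH
  have hHm : Measurable H := hem.edist hem'
  set R : ℝ≥0∞ := (∫⁻ ω, H ω ^ p ∂P) ^ (1 / p) with hR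
  set D : Icc (0 : ℝ) T → ℝ≥0∞ := fun t => wasserstein p (μ t).toMeasure (ν t).toMeasure with hD
  have hpath : ∀ᵐ ω ∂P, ∀ t, edist (X ω t) (Y ω t) ≤
      (2 * G : ℝ≥0) * H ω + (G * L : ℝ≥0) * ∫⁻ s in Iic t, D s ∂timeMeasure T := by
    filter_upwards [hXsol, hYsol] with ω hω hω' t
    refine (hω.edist_apply_le hb hp hω' t).trans ?_
    have h1 : edist (ζ ω) (ζ' ω) + edist (W ω) (W' ω) ≤ 2 * H ω := by
      rw [two_mul]
      exact add_le_add (le_max_left _ _) (le_max_right _ _)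
    calc _ ≤ (G : ℝ≥0∞) * (2 * H ω + L * ∫⁻ s in Iic t, D s ∂timeMeasure T) := by gcongr
      _ = _ := by push_cast; ring
  have hDrec : ∀ t, D t ≤
      (2 * G : ℝ≥0) * R + (G * L : ℝ≥0) * ∫⁻ s in Iic t, D s ∂timeMeasure T := by
    intro t
    exact (IsLawFlow.wasserstein_le hp hXm hYm hμ hν t t).trans
      (lintegral_rpow_le_of_ae_le_mul_add hp hHm (hpath.mono fun ω hω => hω t))
  -- The a priori bound that Grönwall's inequality needs.
  have hDbdd : ∀ t, D t ≤ (∫⁻ ω, edist (X ω) (Y ω) ^ p ∂P) ^ (1 / p) := fun t => by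
    refine (IsLawFlow.wasserstein_le hp hXm hYm hμ hν t t).trans ?_
    gcongr with ω
    exact PathSpace.edist_apply_le _ _ t
  have hfin : (∫⁻ ω, edist (X ω) (Y ω) ^ p ∂P) ^ (1 / p) ≠ ∞ := by
    refine ENNReal.rpow_ne_top_of_nonneg (by positivity) ?_
    simpa [edist_eq_enorm_sub] using
      ((memLp_ofReal_iff_lintegral h0 (hXp.sub hYp).1).1 (hXp.sub hYp)).ne
  have hDle : ∀ t, D t ≤ (G' * (2 * G) : ℝ≥0) * R := fun t => by
    refine (le_of_le_add_lintegral (fun _ _ _ => le_rfl) hfin hDbdd hDrec t).trans_eq ?_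
    push_cast
    ring
  filter_upwards [hpath] with ω hω
  refine PathSpace.edist_le fun t => (hω t).trans ?_
  calc (2 * G : ℝ≥0) * H ω + (G * L : ℝ≥0) * ∫⁻ s in Iic t, D s ∂timeMeasure T
      ≤ (2 * G : ℝ≥0) * H ω +
          (G * L : ℝ≥0) * ∫⁻ _, (G' * (2 * G) : ℝ≥0) * R ∂timeMeasure T := by
        gcongr _ + _ * ?_
        exact (setLIntegral_le_lintegral _ _).trans (lintegral_mono hDle)
    _ = (2 * G : ℝ≥0) * H ω + (G * L * (G' * (2 * G) * V) : ℝ≥0) * R := by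
        rw [lintegral_const, ← ENNReal.coe_toNNReal (measure_ne_top (timeMeasure T) univ), ← hV]
        push_cast
        ring
    _ ≤ (2 * G + G * L * (G' * (2 * G) * V) : ℝ≥0) * H ω +
          (2 * G + G * L * (G' * (2 * G) * V) : ℝ≥0) * R := by
        gcongr
        · exact le_self_add
        · exact le_add_self
    _ = _ := (mul_add _ _ _).symm

lemma ae_eq (hb : DriftAssumption K b) (hp : 1 ≤ p) (hem : Measurable (fun ω => (ζ ω, W ω)))
    (he : MemLp (fun ω => (ζ ω, W ω)) (ENNReal.ofReal p) P)
    (hX : IsMcKeanVlasovSolution b P ζ W X) (hY : IsMcKeanVlasovSolution b P ζ W Y) :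
    X =ᵐ[P] Y := by
  have h0 : 0 < p := one_pos.trans_le hp
  obtain ⟨C, hC⟩ := exists_edist_le hb hp
  filter_upwards [hC hem hem he he hX hY] with ω hω
  simpa [ENNReal.zero_rpow_of_pos h0, h0] using hω

/-- Existence for McKean-Vlasov equations. The solution is a fixed point of the map on
`L^p(Ω; C_T)` that sends `X` to the solution along the flow of laws of `X`; the distance of the images
of `X` and `Y` is controlled by the time integral of the distance of the marginal laws. -/
lemma exists_solution (hb : DriftAssumption K b) (hp : 1 ≤ p)
    (hem : Measurable (fun ω => (ζ ω, W ω)))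
    (he : MemLp (fun ω => (ζ ω, W ω)) (ENNReal.ofReal p) P) :
    ∃ X, IsMcKeanVlasovSolution b P ζ W X := by
  have h0 : 0 < p := one_pos.trans_le hp
  have : Fact (1 ≤ ENNReal.ofReal p) := ⟨by simpa using hp⟩
  have hLm : ∀ X : Lp (PathSpace d T) (ENNReal.ofReal p) P, Measurable X := fun X =>
    (Lp.stronglyMeasurable X).measurable
  choose μ hμ using fun X : Lp (PathSpace d T) (ENNReal.ofReal p) P =>
    exists_isLawFlow hp P (hLm X) (Lp.memLp X)
  choose F hF hFsol using fun X : Lp (PathSpace d T) (ENNReal.ofReal p) P =>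
    (IsLawFlow.isAdmissibleFlow hb hp (hLm X) (Lp.memLp X) (hμ X)).exists_solutionMap hb hp
  have hFm : ∀ X, Measurable fun ω => F X (ζ ω, W ω) := fun X =>
    (hF X).continuous.measurable.comp hem
  have hFp : ∀ X, MemLp (fun ω => F X (ζ ω, W ω)) (ENNReal.ofReal p) P := fun X =>
    memLp_of_edist_le (hFm X).aestronglyMeasurable he (F X 0) 0 _
      (ae_of_all _ fun ω => hF X _ _)
  set L : ℝ≥0 := K ^ (1 / p) with hL
  set g : Lp (PathSpace d T) (ENNReal.ofReal p) P → Lp (PathSpace d T) (ENNReal.ofReal p) P →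
    Icc (0 : ℝ) T → ℝ≥0∞ := fun X Y t => wasserstein p (μ X t).toMeasure (μ Y t).toMeasure
  set Ψ : Lp (PathSpace d T) (ENNReal.ofReal p) P → Lp (PathSpace d T) (ENNReal.ofReal p) P :=
    fun X => (hFp X).toLp
  have hΨae : ∀ X, ∀ᵐ ω ∂P, Ψ X ω = F X (ζ ω, W ω) := fun X => (hFp X).coeFn_toLp
  have hg : ∀ X Y t, g X Y t ≤ (∫⁻ ω, edist (X ω t) (Y ω t) ^ p ∂P) ^ (1 / p) := fun X Y t =>
    IsLawFlow.wasserstein_le hp (hLm X) (hLm Y) (hμ X) (hμ Y) t t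
  have hΨ : ∀ X Y, ∀ᵐ ω ∂P, ∀ t, edist (Ψ X ω t) (Ψ Y ω t) ≤
      (gronwallConst L T * L : ℝ≥0) * ∫⁻ s in Iic t, g X Y s ∂timeMeasure T := by
    intro X Y
    filter_upwards [hΨae X, hΨae Y] with ω hω hω' t
    rw [hω, hω']
    refine ((hFsol X (ζ ω, W ω)).edist_apply_le hb hp (hFsol Y (ζ ω, W ω)) t).trans_eq ?_
    rw [edist_self, edist_self, zero_add, zero_add]
    push_cast
    rw [mul_assoc]
  obtain ⟨X, hX⟩ := exists_fixedPoint_of_volterra Ψ g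
    (fun X Y t => by
      rw [Lp_edist_eq h0]
      refine (hg X Y t).trans ?_
      gcongr with ω
      exact PathSpace.edist_apply_le _ _ t)
    (fun X Y t => (hg _ _ t).trans
      (lintegral_rpow_le_of_ae_le h0 ((hΨ X Y).mono fun ω hω => hω t)))
    (fun X Y => by
      rw [Lp_edist_eq h0]
      refine lintegral_rpow_le_of_ae_le h0 ((hΨ X Y).mono fun ω hω => ?_)
      exact PathSpace.edist_le fun t => (hω t).trans
        (mul_le_mul_right (setLIntegral_le_lintegral _ _) _))
  -- The class `X` has a representative that solves the equation along the flow for every `ω`.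
  refine ⟨fun ω => F X (ζ ω, W ω), hFm X, μ X, fun t => ?_, ae_of_all _ fun ω => hFsol X _⟩
  rw [hμ X t]
  refine Measure.map_congr ((hΨae X).mono fun ω hω => ?_)
  rw [hX] at hω
  exact congrArg (fun x : PathSpace d T => x t) hω

end IsMcKeanVlasovSolution

lemma memLp_of_map_eq {E Ω Ω' : Type*} [NormedAddCommGroup E] [MeasurableSpace E]
    [OpensMeasurableSpace E] [SecondCountableTopology E] [MeasurableSpace Ω] [MeasurableSpace Ω']
    {P : Measure Ω} {Q : Measure Ω'} {q : ℝ≥0∞} {f : Ω → E} {g : Ω' → E} (hf : Measurable f)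
    (hg : Measurable g) (hgq : MemLp g q Q) (h : P.map f = Q.map g) : MemLp f q P := by
  have hid : MemLp id q (Q.map g) :=
    (memLp_map_measure_iff aestronglyMeasurable_id hg.aemeasurable).2 hgq
  rw [← h] at hid
  exact (memLp_map_measure_iff aestronglyMeasurable_id hf.aemeasurable).1 hid

namespace IsMcKeanVlasovSolution

variable {d : ℕ} {T p : ℝ} {K : ℝ≥0} {b : Drift d T p}

/-- A McKean-Vlasov solution is a function `F` of its input, and the same function solves the equation
for any other input with the same law, on any probability space. -/
lemma exists_transfer (hb : DriftAssumption K b) (hp : 1 ≤ p) {Ω : Type*} [MeasurableSpace Ω]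
    {P : Measure Ω} [IsProbabilityMeasure P] {ζ : Ω → State d} {W X : Ω → PathSpace d T}
    (hem : Measurable fun ω => (ζ ω, W ω))
    (he : MemLp (fun ω => (ζ ω, W ω)) (ENNReal.ofReal p) P)
    (hX : IsMcKeanVlasovSolution b P ζ W X) :
    ∃ F : State d × PathSpace d T → PathSpace d T, Measurable F ∧
      P.map X = (P.map fun ω => (ζ ω, W ω)).map F ∧
      ∀ {S : Type*} [MeasurableSpace S] {m : Measure S} {e : S → State d × PathSpace d T},
        Measurable e → m.map e = P.map (fun ω => (ζ ω, W ω)) →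
        IsMcKeanVlasovSolution b m (fun s => (e s).1) (fun s => (e s).2) fun s => F (e s) := by
  obtain ⟨μ, F, hF, hμ, hsol, hXF⟩ := hX.exists_solutionMap hb hp he
  refine ⟨F, hF, ?_, ?_⟩
  · rw [Measure.map_map hF hem]
    exact Measure.map_congr hXF
  · intro S _ m e hem' hlaw
    refine ⟨hF.comp hem', μ, fun t => ?_, ae_of_all _ fun s => hsol (e s)⟩
    have hFt : Measurable fun e => F e t := (PathSpace.measurable_eval t).comp hF
    calc (μ t).toMeasure = P.map fun ω => X ω t := hμ t
      _ = P.map ((fun e => F e t) ∘ fun ω => (ζ ω, W ω)) :=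
        Measure.map_congr (hXF.mono fun ω hω => congrArg (fun x : PathSpace d T => x t) hω)
      _ = (m.map e).map fun e => F e t := by rw [← Measure.map_map hFt hem, hlaw]
      _ = m.map fun s => F (e s) t := Measure.map_map hFt hem'

/-- **Wasserstein stability of McKean-Vlasov equations**: the law of the solution is a Lipschitz
continuous function of the law of the input. A coupling of two laws of inputs is a probability space
which carries both inputs, and there the stability on one probability space applies. -/
theorem exists_wasserstein_le (hb : DriftAssumption K b) (hp : 1 ≤ p) :
    ∃ C : ℝ≥0, ∀ {Ω Ω' : Type*} [MeasurableSpace Ω] [MeasurableSpace Ω'] {P : Measure Ω}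
      {Q : Measure Ω'} [IsProbabilityMeasure P] [IsProbabilityMeasure Q]
      {ζ : Ω → State d} {W X : Ω → PathSpace d T} {ζ' : Ω' → State d} {W' Y : Ω' → PathSpace d T},
      Measurable (fun ω => (ζ ω, W ω)) → Measurable (fun ω => (ζ' ω, W' ω)) →
      MemLp (fun ω => (ζ ω, W ω)) (ENNReal.ofReal p) P →
      MemLp (fun ω => (ζ' ω, W' ω)) (ENNReal.ofReal p) Q →
      IsMcKeanVlasovSolution b P ζ W X → IsMcKeanVlasovSolution b Q ζ' W' Y →
      wasserstein p (P.map X) (Q.map Y) ^ p ≤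
        C * wasserstein p (P.map fun ω => (ζ ω, W ω)) (Q.map fun ω => (ζ' ω, W' ω)) ^ p := by
  have h0 : 0 < p := one_pos.trans_le hp
  obtain ⟨C, hC⟩ := exists_edist_le hb hp
  -- The summand `1` makes the constant nonzero, so that it can be moved into the infimum.
  refine ⟨(C + C + 1) ^ p, ?_⟩
  intro Ω Ω' _ _ P Q _ _ ζ W X ζ' W' Y hem hem' he he' hX hY
  obtain ⟨F, hF, hXF, hFsol⟩ := hX.exists_transfer hb hp hem he
  obtain ⟨F', hF', hYF, hFsol'⟩ := hY.exists_transfer hb hp hem' he'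
  rw [wasserstein_rpow h0 (P.map fun ω => (ζ ω, W ω)), ENNReal.mul_iInf_of_ne
    (ENNReal.coe_ne_zero.2 (NNReal.rpow_pos (by positivity)).ne') ENNReal.coe_ne_top]
  refine le_iInf fun m => ?_
  by_cases hm : IsCoupling m (P.map fun ω => (ζ ω, W ω)) (Q.map fun ω => (ζ' ω, W' ω))
  swap
  · simp [hm]
  rw [iInf_pos hm]
  have hprob : IsProbabilityMeasure m := by
    rw [← Measure.isProbabilityMeasure_map_iff measurable_fst.aemeasurable, hm.1]
    exact Measure.isProbabilityMeasure_map hem.aemeasurable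
  have hae := hC (P := m) (ζ := fun z => z.1.1) (W := fun z => z.1.2) (ζ' := fun z => z.2.1)
    (W' := fun z => z.2.2) measurable_fst measurable_snd
    (memLp_of_map_eq measurable_fst hem he hm.1) (memLp_of_map_eq measurable_snd hem' he' hm.2)
    (hFsol measurable_fst hm.1) (hFsol' measurable_snd hm.2)
  set R : ℝ≥0∞ := (∫⁻ z, edist z.1 z.2 ^ p ∂m) ^ (1 / p) with hR
  have hW : wasserstein p (P.map X) (Q.map Y) ≤ (C + C + 1 : ℝ≥0) * R := by
    calc wasserstein p (P.map X) (Q.map Y)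
        = wasserstein p (m.map fun z => F z.1) (m.map fun z => F' z.2) := by
          rw [hXF, hYF, ← hm.1, ← hm.2, Measure.map_map hF measurable_fst,
            Measure.map_map hF' measurable_snd]
          rfl
      _ ≤ (∫⁻ z, edist (F z.1) (F' z.2) ^ p ∂m) ^ (1 / p) :=
          wasserstein_map_le h0.le m (hF.comp measurable_fst) (hF'.comp measurable_snd)
      _ ≤ C * R + C * R :=
          lintegral_rpow_le_of_ae_le_mul_add hp measurable_edist
            (hae.mono fun z hz => hz.trans_eq (mul_add _ _ _))
      _ ≤ (C + C + 1 : ℝ≥0) * R := by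
          push_cast
          rw [add_mul, add_mul]
          exact le_self_add
  calc wasserstein p (P.map X) (Q.map Y) ^ p ≤ ((C + C + 1 : ℝ≥0) * R) ^ p := by gcongr
    _ = ((C + C + 1) ^ p : ℝ≥0) * ∫⁻ z, edist z.1 z.2 ^ p ∂m := by
        rw [ENNReal.mul_rpow_of_nonneg _ _ h0.le, hR, ← ENNReal.rpow_mul,
          one_div_mul_cancel h0.ne', ENNReal.rpow_one, ENNReal.coe_rpow_of_nonneg _ h0.le]

end IsMcKeanVlasovSolution

/-! ### Particle systems -/

section Particles

variable {d : ℕ} {T p : ℝ} {K : ℝ≥0} {b : Drift d T p} {N : ℕ} [NeZero N]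

/-- The particle system is the McKean-Vlasov equation on the set of particles with the uniform
distribution. -/
lemma isParticleSolution_iff (hp : 0 ≤ p) {z : Fin N → State d} {w x : Fin N → PathSpace d T} :
    IsParticleSolution hp b z w x ↔ IsMcKeanVlasovSolution b (uniformIndex N) z w x := by
  constructor
  · exact fun h => ⟨measurable_of_countable x, _, fun t => (map_uniformIndex _).symm,
      ae_of_all _ h⟩
  · rintro ⟨-, μ, hμ, hsol⟩
    have hμ' : μ = fun s => empiricalLaw p hp fun j => x j s :=
      funext fun t => ProbMoment.ext ((hμ t).trans (map_uniformIndex _))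
    rw [hμ'] at hsol
    exact ae_uniformIndex.1 hsol

lemma exists_isParticleSolution (hb : DriftAssumption K b) (hp : 1 ≤ p) (z : Fin N → State d)
    (w : Fin N → PathSpace d T) :
    ∃ x, IsParticleSolution (zero_le_one.trans hp) b z w x := by
  simp_rw [isParticleSolution_iff]
  exact IsMcKeanVlasovSolution.exists_solution hb hp (measurable_of_countable _) .of_discrete

lemma IsParticleSolution.unique (hb : DriftAssumption K b) (hp : 1 ≤ p) {z : Fin N → State d}
    {w x y : Fin N → PathSpace d T} (hx : IsParticleSolution (zero_le_one.trans hp) b z w x)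
    (hy : IsParticleSolution (zero_le_one.trans hp) b z w y) : x = y :=
  funext (ae_uniformIndex.1 (((isParticleSolution_iff _).1 hx).ae_eq hb hp
    (measurable_of_countable _) .of_discrete ((isParticleSolution_iff _).1 hy)))

/-- The solution map of the particle system is continuous, by stability on the uniform probability
space of particles. -/
lemma continuous_of_isParticleSolution (hb : DriftAssumption K b) (hp : 1 ≤ p)
    {G : (Fin N → State d × PathSpace d T) → Fin N → PathSpace d T}
    (hG : ∀ e, IsParticleSolution (zero_le_one.trans hp) b (fun i => (e i).1) (fun i => (e i).2)
      (G e)) : Continuous G := by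
  have h0 : 0 < p := one_pos.trans_le hp
  obtain ⟨C, hC⟩ := IsMcKeanVlasovSolution.exists_edist_le hb hp
  refine LipschitzWith.continuous (K := C * 2) fun e e' => edist_pi_le_iff.2 fun i => ?_
  have h := ae_uniformIndex.1 (hC (measurable_of_countable _) (measurable_of_countable _)
    .of_discrete .of_discrete ((isParticleSolution_iff _).1 (hG e))
    ((isParticleSolution_iff _).1 (hG e'))) i
  refine h.trans ?_
  push_cast
  rw [mul_assoc, two_mul]
  gcongr
  · exact edist_le_pi_edist e e' i
  · exact lintegral_rpow_le_of_ae_le h0 (ae_of_all _ fun j => edist_le_pi_edist e e' j)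

end Particles

/-! ### Well-posedness and stability -/

theorem theorem3p1 {d : ℕ} {T p : ℝ} (hT : 0 < T) (hp : 1 ≤ p) {K : ℝ≥0} (b : Drift d T p)
    (hb : DriftAssumption K b) :
    -- (i) pathwise well-posedness of the particle system, for every `ω`, with measurability in `ω`
    (∀ (Ω : Type*) [MeasurableSpace Ω] (N : ℕ) [NeZero N]
        (ζ : Fin N → Ω → State d) (W : Fin N → Ω → PathSpace d T),
        (∀ i, Measurable (ζ i)) → (∀ i, Measurable (W i)) →
        ∃ X : Ω → Fin N → PathSpace d T, Measurable X ∧ ∀ ω,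
          IsParticleSolution (zero_le_one.trans hp) b (fun i => ζ i ω) (fun i => W i ω) (X ω) ∧
          ∀ x : Fin N → PathSpace d T,
            IsParticleSolution (zero_le_one.trans hp) b (fun i => ζ i ω) (fun i => W i ω) x →
            x = X ω) ∧
    -- (ii) well-posedness of the McKean-Vlasov equation
    (∀ (Ω : Type*) [MeasurableSpace Ω] (P : Measure Ω) [IsProbabilityMeasure P]
        (ζbar : Ω → State d) (Wbar : Ω → PathSpace d T),
        Measurable ζbar → Measurable Wbar →
        MemLp ζbar (ENNReal.ofReal p) P → MemLp Wbar (ENNReal.ofReal p) P →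
        ∃ Xbar : Ω → PathSpace d T, IsMcKeanVlasovSolution b P ζbar Wbar Xbar ∧
          ∀ Y : Ω → PathSpace d T, IsMcKeanVlasovSolution b P ζbar Wbar Y → Y =ᵐ[P] Xbar) ∧
    -- (iii) stability estimate, with a constant that depends neither on `N` nor on the inputs
    (∃ C : ℝ≥0, ∀ (Ω : Type*) [MeasurableSpace Ω] (P : Measure Ω) [IsProbabilityMeasure P]
        (ζbar : Ω → State d) (Wbar : Ω → PathSpace d T),
        Measurable ζbar → Measurable Wbar →
        MemLp ζbar (ENNReal.ofReal p) P → MemLp Wbar (ENNReal.ofReal p) P →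
        ∀ Xbar : Ω → PathSpace d T, IsMcKeanVlasovSolution b P ζbar Wbar Xbar →
        ∀ (N : ℕ) [NeZero N] (ζ : Fin N → Ω → State d) (W : Fin N → Ω → PathSpace d T),
        (∀ i, Measurable (ζ i)) → (∀ i, Measurable (W i)) →
        ∀ X : Ω → Fin N → PathSpace d T,
        (∀ᵐ ω ∂P, IsParticleSolution (zero_le_one.trans hp) b
          (fun i => ζ i ω) (fun i => W i ω) (X ω)) →
        ∀ᵐ ω ∂P,
          wasserstein p (empiricalMeasure (X ω)) (P.map Xbar) ^ p ≤
            C * wasserstein p (empiricalMeasure fun i => (ζ i ω, W i ω))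
              (P.map fun ω' => (ζbar ω', Wbar ω')) ^ p) := by
  have h0 : (0 : ℝ) ≤ p := zero_le_one.trans hp
  refine ⟨?_, ?_, ?_⟩
  · intro Ω _ N _ ζ W hζ hW
    choose G hG using fun e : Fin N → State d × PathSpace d T =>
      exists_isParticleSolution hb hp (fun i => (e i).1) fun i => (e i).2
    refine ⟨fun ω => G fun i => (ζ i ω, W i ω), ?_, fun ω =>
      ⟨hG _, fun x hx => hx.unique hb hp (hG fun i => (ζ i ω, W i ω))⟩⟩
    exact (continuous_of_isParticleSolution hb hp hG).measurable.comp
      (measurable_pi_lambda _ fun i => (hζ i).prodMk (hW i))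
  · intro Ω _ P _ ζbar Wbar hζ hW hζp hWp
    have hem := hζ.prodMk hW
    have he := MemLp.of_fst_snd (f := fun ω => (ζbar ω, Wbar ω)) ⟨hζp, hWp⟩
    obtain ⟨X, hX⟩ := IsMcKeanVlasovSolution.exists_solution hb hp hem he
    exact ⟨X, hX, fun Y hY => hY.ae_eq hb hp hem he hX⟩
  · obtain ⟨C, hC⟩ := IsMcKeanVlasovSolution.exists_wasserstein_le hb hp
    refine ⟨C, ?_⟩
    intro Ω _ P _ ζbar Wbar hζ hW hζp hWp Xbar hXbar N _ ζ W _ _ X hX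
    have he := MemLp.of_fst_snd (f := fun ω => (ζbar ω, Wbar ω)) ⟨hζp, hWp⟩
    filter_upwards [hX] with ω hω
    rw [← map_uniformIndex, ← map_uniformIndex]
    exact hC (measurable_of_countable _) (hζ.prodMk hW) .of_discrete he
      ((isParticleSolution_iff h0).1 hω) hXbar
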